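/- Let $K$ be a perfect field of characteristic $p>0$ and let $K\subseteq Q\subseteq Q'$ be fields such that $Q$ and $Q'$ are finitely generated as field extensions of $K$ and $Q'$ is a separable algebraic extension of $Q$. For a commutative $K$-algebra $B$ let $\mathcal D_K(B)=\bigcup_{i\ge 0}\mathcal D_K(B)_i\subseteq \mathrm{End}_K(B)$ be the algebra of $K$-linear differential operators on $B$, where $\mathcal D_K(B)_0=\mathrm{End}_B(B)$ and, for $i\ge 1$, $\mathcal D_K(B)_i=\{u\in\mathrm{End}_K(B) : ru-ur\in \mathcal D_K(B)_{i-1}\text{ for all } r\in B\}$. Then every $u\in\mathcal D_K(Q)$ extends to a unique differential operator in $\mathcal D_K(Q')$; the resulting map $\mathcal D_K(Q)\to\mathcal D_K(Q')$ is an injective $K$-algebra homomorphism, and, regarding $\mathcal D_K(Q)$ as a subalgebra of $\mathcal D_K(Q')$ through it, $$\mathcal D_K(Q')=Q'\,\mathcal D_K(Q),$$ i.e. $\mathcal D_K(Q')$ is the left $Q'$-linear span of $\mathcal D_K(Q)$. -/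

import Mathlib

/-- The commutator `[r, u] = r u - u r` of the multiplication by `r` with a `K`-linear
endomorphism `u` of the `K`-algebra `B`. -/
def mulComm (K : Type*) {B : Type*} [CommRing K] [CommRing B] [Algebra K B]
    (r : B) (u : Module.End K B) : Module.End K B :=
  LinearMap.mulLeft K r * u - u * LinearMap.mulLeft K r

theorem mulComm_add {K B : Type*} [CommRing K] [CommRing B] [Algebra K B]
    (r : B) (u v : Module.End K B) : mulComm K r (u + v) = mulComm K r u + mulComm K r v := by
  unfold mulComm; noncomm_ring

theorem mulComm_smul {K B : Type*} [CommRing K] [CommRing B] [Algebra K B]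
    (r b : B) (u : Module.End K B) : mulComm K r (b • u) = b • mulComm K r u := by
  ext x
  simp only [mulComm, LinearMap.sub_apply, Module.End.mul_apply, LinearMap.mulLeft_apply,
    LinearMap.smul_apply, smul_eq_mul]
  ring

theorem mulComm_mul {K B : Type*} [CommRing K] [CommRing B] [Algebra K B]
    (r : B) (u v : Module.End K B) :
    mulComm K r (u * v) = mulComm K r u * v + u * mulComm K r v := by
  simp only [mulComm, sub_mul, mul_sub, mul_assoc]; abel

/-- The order filtration `D_K(B)_0 ⊆ D_K(B)_1 ⊆ ...` on the differential operators of `B`: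
`D_K(B)_0 = End_B(B)`, and `u ∈ D_K(B)_{i+1}` iff `[r, u] ∈ D_K(B)_i` for every `r ∈ B`. -/
def diffOpOrder (K B : Type*) [CommRing K] [CommRing B] [Algebra K B] :
    ℕ → Submodule B (Module.End K B)
  | 0 =>
    { carrier := {u | ∀ b x : B, u (b * x) = b * u x}
      zero_mem' := fun b x => by simp
      add_mem' := fun {u v} hu hv b x => by
        simp only [LinearMap.add_apply, hu b x, hv b x, mul_add]
      smul_mem' := fun c u hu b x => by
        simp only [LinearMap.smul_apply, hu b x, smul_eq_mul]; ring }
  | i + 1 =>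
    { carrier := {u | ∀ r : B, mulComm K r u ∈ diffOpOrder K B i}
      zero_mem' := fun r => by
        have h : mulComm K r (0 : Module.End K B) = 0 := by simp [mulComm]
        rw [h]; exact Submodule.zero_mem _
      add_mem' := fun {u v} hu hv r => by
        rw [mulComm_add]; exact Submodule.add_mem _ (hu r) (hv r)
      smul_mem' := fun c u hu r => by
        rw [mulComm_smul]; exact Submodule.smul_mem _ c (hu r) }

theorem mem_diffOpOrder_zero {K B : Type*} [CommRing K] [CommRing B] [Algebra K B]
    {u : Module.End K B} : u ∈ diffOpOrder K B 0 ↔ ∀ b x : B, u (b * x) = b * u x := Iff.rfl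

theorem mem_diffOpOrder_succ {K B : Type*} [CommRing K] [CommRing B] [Algebra K B] {i : ℕ}
    {u : Module.End K B} :
    u ∈ diffOpOrder K B (i + 1) ↔ ∀ r : B, mulComm K r u ∈ diffOpOrder K B i := Iff.rfl

theorem mulComm_eq_zero_of_mem {K B : Type*} [CommRing K] [CommRing B] [Algebra K B]
    {u : Module.End K B} (hu : u ∈ diffOpOrder K B 0) (r : B) : mulComm K r u = 0 := by
  ext x
  simp [mulComm, mem_diffOpOrder_zero.1 hu r x]

theorem diffOpOrder_mono (K B : Type*) [CommRing K] [CommRing B] [Algebra K B] :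
    Monotone (diffOpOrder K B) := by
  refine monotone_nat_of_le_succ fun i => ?_
  induction i with
  | zero =>
    intro u hu r
    rw [mulComm_eq_zero_of_mem hu r]
    exact Submodule.zero_mem _
  | succ i ih => exact fun u hu r => ih (hu r)

theorem mul_mem_diffOpOrder {K B : Type*} [CommRing K] [CommRing B] [Algebra K B] (n : ℕ) :
    ∀ i j : ℕ, i + j = n → ∀ u ∈ diffOpOrder K B i, ∀ v ∈ diffOpOrder K B j,
      u * v ∈ diffOpOrder K B n := by
  induction n with
  | zero =>
    intro i j h u hu v hv
    obtain ⟨rfl, rfl⟩ : i = 0 ∧ j = 0 := by omega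
    intro b x
    rw [Module.End.mul_apply, Module.End.mul_apply, hv b x, hu b (v x)]
  | succ n ih =>
    intro i j h u hu v hv r
    rw [mulComm_mul]
    refine Submodule.add_mem _ ?_ ?_
    · cases i with
      | zero => rw [mulComm_eq_zero_of_mem hu r, zero_mul]; exact Submodule.zero_mem _
      | succ i => exact ih i j (by omega) _ (hu r) v hv
    · cases j with
      | zero => rw [mulComm_eq_zero_of_mem hv r, mul_zero]; exact Submodule.zero_mem _
      | succ j => exact ih i j (by omega) u hu _ (hv r)

/-- The algebra `D_K(B)` of `K`-linear differential operators on the commutative `K`-algebra `B`,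
the union of the order filtration. -/
def diffOp (K B : Type*) [CommRing K] [CommRing B] [Algebra K B] :
    Subalgebra K (Module.End K B) where
  carrier := {u | ∃ i : ℕ, u ∈ diffOpOrder K B i}
  mul_mem' := fun ⟨i, hi⟩ ⟨j, hj⟩ => ⟨i + j, mul_mem_diffOpOrder _ i j rfl _ hi _ hj⟩
  add_mem' := fun ⟨i, hi⟩ ⟨j, hj⟩ =>
    ⟨max i j, Submodule.add_mem _ (diffOpOrder_mono K B (le_max_left i j) hi)
      (diffOpOrder_mono K B (le_max_right i j) hj)⟩
  algebraMap_mem' := fun c => ⟨0, fun b x => by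
    simp [Module.algebraMap_end_apply]⟩

/-- The `K`-linear endomorphism `v` of `B'` extends the `K`-linear endomorphism `u` of `B`. -/
def OpExtends {K B B' : Type*} [CommRing K] [CommRing B] [CommRing B'] [Algebra K B]
    [Algebra K B'] [Algebra B B'] (u : Module.End K B) (v : Module.End K B') : Prop :=
  ∀ a : B, v (algebraMap B B' a) = algebraMap B B' (u a)

/-! In characteristic `p`, the differential operators on an essentially finitely generated algebra
`B` are the endomorphisms linear over the `p ^ n`-th powers of `B` for some `n`
(`exists_isFrobeniusLinear_of_mem_diffOp`, `IsFrobeniusLinear.mem_diffOp`). For `Q'` separable over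
`Q`, the `p ^ n`-th powers of a basis again form a basis, so `Q'` is the base change of `Q` from
`Q^(p^n)` to `Q'^(p^n)`. Hence a `Q^(p^n)`-linear map of `Q` has exactly one `Q'^(p^n)`-linear
extension. Since `K` is perfect, `Q` is finite over `Q^(p^n)`. A basis `e i` with coordinate
operators `d i`, extended to `d' i`, gives `v = ∑ i, v (e i) • d' i`, because both sides agree on
`Q`. -/

open scoped TensorProduct

/-! ### Operator order and powers of the diagonal ideal. -/

section BimoduleAction

variable {K B : Type*} [CommRing K] [CommRing B] [Algebra K B]

/-- The right action of `B` on `End_K(B)`: precomposition with multiplications. -/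
def mulRightAction (K B : Type*) [CommRing K] [CommRing B] [Algebra K B] :
    B →ₐ[K] Module.End K (Module.End K B) :=
  AlgHom.ofLinearMap ((LinearMap.mul K (Module.End K B)).flip ∘ₗ (Algebra.lmul K B).toLinearMap)
    (by ext; simp) (fun a b => by ext; simp [mul_assoc, mul_left_comm b a])

/-- The action of `B ⊗ B` on `End_K(B)`; the first factor acts by precomposition, the second one by
postcomposition. -/
def tensorAction (K B : Type*) [CommRing K] [CommRing B] [Algebra K B] :
    B ⊗[K] B →ₐ[K] Module.End K (Module.End K B) :=
  Algebra.TensorProduct.lift (mulRightAction K B)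
    ((Algebra.lmul K (Module.End K B)).comp (Algebra.lmul K B))
    (fun a b => by
      ext u x
      simp [mulRightAction])

theorem tensorAction_diff (r : B) (u : Module.End K B) :
    tensorAction K B ((1 : B) ⊗ₜ[K] r - r ⊗ₜ[K] (1 : B)) u = mulComm K r u := by
  ext x
  simp [tensorAction, mulRightAction, mulComm]

/-- Each factor acts as a commutator and lowers the order by one. -/
theorem tensorAction_diff_pow_eq_zero {i : ℕ} (r : B) :
    ∀ u ∈ diffOpOrder K B i,
      tensorAction K B (((1 : B) ⊗ₜ[K] r - r ⊗ₜ[K] (1 : B)) ^ (i + 1)) u = 0 := by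
  induction i with
  | zero =>
    intro u hu
    rw [zero_add, pow_one, tensorAction_diff, mulComm_eq_zero_of_mem hu]
  | succ i ih =>
    intro u hu
    rw [pow_succ, map_mul, Module.End.mul_apply, tensorAction_diff]
    exact ih _ (hu r)

theorem mem_diffOpOrder_of_tensorAction_eq_zero {i : ℕ} :
    ∀ u : Module.End K B,
      (∀ t ∈ KaehlerDifferential.ideal K B ^ (i + 1), tensorAction K B t u = 0) →
      u ∈ diffOpOrder K B i := by
  have key (r : B) : (1 : B) ⊗ₜ[K] r - r ⊗ₜ[K] (1 : B) ∈ KaehlerDifferential.ideal K B :=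
    KaehlerDifferential.one_smul_sub_smul_one_mem_ideal K r
  induction i with
  | zero =>
    intro u hu b x
    have := hu _ (by rw [zero_add, pow_one]; exact key b)
    rw [tensorAction_diff] at this
    have := LinearMap.congr_fun this x
    simpa [mulComm, sub_eq_zero, eq_comm (a := u _)] using this
  | succ i ih =>
    intro u hu r
    refine ih _ fun t ht => ?_
    rw [← tensorAction_diff, ← Module.End.mul_apply, ← map_mul]
    refine hu _ ?_
    rw [pow_succ _ (i + 1)]
    exact Ideal.mul_mem_mul ht (key r)

end BimoduleAction

/-! ### Differential operators as Frobenius-linear maps. -/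

section FrobeniusLinear

/-- The endomorphism `u` is linear over the subring of `p ^ n`-th powers. -/
def IsFrobeniusLinear {B : Type*} [Semiring B] (p n : ℕ) (u : B → B) : Prop :=
  ∀ r x : B, u (r ^ p ^ n * x) = r ^ p ^ n * u x

theorem IsFrobeniusLinear.of_le {B : Type*} [CommSemiring B] {p m n : ℕ} {u : B → B}
    (hu : IsFrobeniusLinear p m u) (hmn : m ≤ n) : IsFrobeniusLinear p n u := by
  intro r x
  obtain ⟨k, rfl⟩ := Nat.exists_eq_add_of_le hmn
  rw [pow_add, mul_comm (p ^ m), pow_mul]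
  exact hu _ _

variable {K B : Type*} [CommRing K] [CommRing B] [Algebra K B] (p : ℕ)

theorem tensorAction_diff_pow [Fact p.Prime] [CharP K p] (n : ℕ) (r : B)
    (u : Module.End K B) :
    tensorAction K B (((1 : B) ⊗ₜ[K] r - r ⊗ₜ[K] (1 : B)) ^ p ^ n) u = mulComm K (r ^ p ^ n) u := by
  rw [← tensorAction_diff]
  -- The zero ring does not have characteristic `p`, so it is treated apart.
  rcases subsingleton_or_nontrivial (B ⊗[K] B) with h | h
  · congr 2
    exact Subsingleton.elim _ _
  · have : CharP (B ⊗[K] B) p := by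
      rw [CharP.charP_iff_prime_eq_zero Fact.out, ← map_natCast (algebraMap K (B ⊗[K] B)),
        CharP.cast_eq_zero, map_zero]
    rw [sub_pow_char_pow, Algebra.TensorProduct.tmul_pow, Algebra.TensorProduct.tmul_pow, one_pow]

theorem isFrobeniusLinear_iff_mulComm {n : ℕ} {u : Module.End K B} :
    IsFrobeniusLinear p n u ↔ ∀ r : B, mulComm K (r ^ p ^ n) u = 0 := by
  refine forall_congr' fun r => ?_
  rw [LinearMap.ext_iff]
  refine forall_congr' fun x => ?_
  simp [mulComm, sub_eq_zero, eq_comm (a := u _)]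

theorem exists_isFrobeniusLinear_of_mem_diffOp [Fact p.Prime] [CharP K p] {u : Module.End K B}
    (hu : u ∈ diffOp K B) : ∃ n, IsFrobeniusLinear p n u := by
  obtain ⟨i, hi⟩ := hu
  refine ⟨i + 1, (isFrobeniusLinear_iff_mulComm p).2 fun r => ?_⟩
  rw [← tensorAction_diff_pow]
  obtain ⟨k, hk⟩ := Nat.exists_eq_add_of_le
    (Nat.lt_pow_self (Fact.out : p.Prime).one_lt : i + 1 < p ^ (i + 1)).le
  rw [hk, add_comm (i + 1) k, pow_add, map_mul, Module.End.mul_apply,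
    tensorAction_diff_pow_eq_zero r u hi, map_zero]

/-- The annihilator of `u` in `B ⊗ B` contains a power of each generator of the diagonal ideal; as
that ideal is finitely generated, some power of the whole ideal kills `u`. -/
theorem IsFrobeniusLinear.mem_diffOp [Fact p.Prime] [CharP K p] [Algebra.EssFiniteType K B]
    {n : ℕ} {u : Module.End K B} (hu : IsFrobeniusLinear p n u) : u ∈ diffOp K B := by
  let J : Ideal (B ⊗[K] B) :=
    { carrier := {t | tensorAction K B t u = 0}
      zero_mem' := by simp
      add_mem' := fun {a b} ha hb => by
        simp only [Set.mem_ofPred_eq] at ha hb ⊢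
        rw [map_add, LinearMap.add_apply, ha, hb, add_zero]
      smul_mem' := fun c t ht => by
        simp only [Set.mem_ofPred_eq] at ht ⊢
        rw [smul_eq_mul, map_mul, Module.End.mul_apply, ht, map_zero] }
  have hJ : KaehlerDifferential.ideal K B ≤ J.radical := by
    rw [← KaehlerDifferential.span_range_eq_ideal, Ideal.span_le]
    rintro _ ⟨r, rfl⟩
    refine ⟨p ^ n, ?_⟩
    change tensorAction K B _ u = 0
    rw [tensorAction_diff_pow, (isFrobeniusLinear_iff_mulComm p).1 hu]
  obtain ⟨N, hN⟩ := Ideal.exists_pow_le_of_le_radical_of_fg hJ (KaehlerDifferential.ideal_fg K B)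
  exact ⟨N, mem_diffOpOrder_of_tensorAction_eq_zero u fun t ht =>
    hN (Ideal.pow_le_pow_right N.le_succ ht)⟩

end FrobeniusLinear

theorem IsFrobeniusLinear.apply_smul_pow {K F E : Type*} [CommRing K] [CommRing F] [CommRing E]
    [Algebra K E] [Algebra F E] {p n : ℕ} {v : Module.End K E}
    (hv : IsFrobeniusLinear p n v) (a : F) (c : E) :
    v (a • c ^ p ^ n) = v (algebraMap F E a) * c ^ p ^ n := by
  rw [Algebra.smul_def, mul_comm, hv, mul_comm]

/-! ### Extension along separable field extensions. -/

section SeparableExtension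

variable {K F E : Type*} [Field K] [Field F] [Field E] [Algebra K F] [Algebra K E] [Algebra F E]
  [IsScalarTower K F E] (p : ℕ) [Fact p.Prime]

/-- The `p ^ n`-th powers of a basis of a separable extension form a basis. -/
noncomputable def Module.Basis.powCharPow [CharP F p] [Algebra.IsSeparable F E] {ι : Type*}
    (w : Module.Basis ι F E) (n : ℕ) : Module.Basis ι F E :=
  Module.Basis.mk (w.linearIndependent.map_pow_expChar_pow_of_isSeparable p n)
    (Field.span_map_pow_expChar_pow_eq_top_of_isSeparable p n w.span_eq).ge

@[simp]
theorem Module.Basis.powCharPow_apply [CharP F p] [Algebra.IsSeparable F E] {ι : Type*}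
    (w : Module.Basis ι F E) (n : ℕ) (i : ι) : w.powCharPow p n i = w i ^ p ^ n :=
  Module.Basis.mk_apply _ _ i

/-- The coordinatewise extension of an endomorphism of `F` along a basis of `E` over `F`. -/
noncomputable def coordExtend {ι : Type*} (β : Module.Basis ι F E) (u : Module.End K F) :
    Module.End K E :=
  (β.repr.restrictScalars K).symm.toLinearMap ∘ₗ Finsupp.mapRange.linearMap u ∘ₗ
    (β.repr.restrictScalars K).toLinearMap

theorem coordExtend_smul {ι : Type*} (β : Module.Basis ι F E) (u : Module.End K F) (a : F) (i : ι) :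
    coordExtend β u (a • β i) = u a • β i := by
  simp [coordExtend]

/-- Frobenius is additive, and the scalars `s ^ p ^ n` it produces pass through `u`, so the formula
spreads from basis vectors to all `c`. -/
theorem coordExtend_smul_pow [CharP F p] [Algebra.IsSeparable F E] {ι : Type*}
    (w : Module.Basis ι F E) {n : ℕ} {u : Module.End K F} (hu : IsFrobeniusLinear p n u)
    (a : F) (c : E) :
    coordExtend (w.powCharPow p n) u (a • c ^ p ^ n) = u a • c ^ p ^ n := by
  have : CharP E p := charP_of_injective_algebraMap (algebraMap F E).injective p
  induction w.mem_span c using Submodule.span_induction generalizing a with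
  | mem x hx =>
    obtain ⟨i, rfl⟩ := hx
    rw [← w.powCharPow_apply p n i, coordExtend_smul]
  | zero => simp [(Fact.out : p.Prime).ne_zero]
  | add x y _ _ hx hy => rw [add_pow_char_pow, smul_add, map_add, hx, hy, smul_add]
  | smul s x _ hx =>
    rw [smul_pow, smul_smul, hx, mul_comm, hu, mul_comm, smul_smul]

variable (F) in
theorem IsFrobeniusLinear.ext_of_isSeparable [CharP F p] [Algebra.IsSeparable F E] {n : ℕ}
    {v v' : Module.End K E} (hv : IsFrobeniusLinear p n v) (hv' : IsFrobeniusLinear p n v')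
    (h : ∀ a : F, v (algebraMap F E a) = v' (algebraMap F E a)) : v = v' := by
  let w := Module.Basis.ofVectorSpace F E
  ext x
  rw [← (w.powCharPow p n).linearCombination_repr x, Finsupp.linearCombination_apply,
    Finsupp.sum, map_sum, map_sum]
  refine Finset.sum_congr rfl fun i _ => ?_
  rw [w.powCharPow_apply p, hv.apply_smul_pow, hv'.apply_smul_pow, h]

variable (E) in
theorem IsFrobeniusLinear.exists_extends [CharP F p] [Algebra.IsSeparable F E] {n : ℕ}
    {u : Module.End K F} (hu : IsFrobeniusLinear p n u) :
    ∃ v : Module.End K E, IsFrobeniusLinear p n v ∧ OpExtends u v := by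
  let w := Module.Basis.ofVectorSpace F E
  refine ⟨coordExtend (w.powCharPow p n) u, fun r x => ?_, fun a => ?_⟩
  · rw [← (w.powCharPow p n).linearCombination_repr x, Finsupp.linearCombination_apply,
      Finsupp.sum, Finset.mul_sum, map_sum, map_sum, Finset.mul_sum]
    refine Finset.sum_congr rfl fun i _ => ?_
    rw [w.powCharPow_apply p, mul_smul_comm, ← mul_pow, coordExtend_smul_pow p w hu,
      coordExtend_smul_pow p w hu, mul_pow, mul_smul_comm]
  · have := coordExtend_smul_pow p w hu a 1
    rwa [one_pow, ← Algebra.algebraMap_eq_smul_one, ← Algebra.algebraMap_eq_smul_one] at this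

end SeparableExtension

/-! ### Finiteness over the subfield of `p ^ n`-th powers. -/

section PerfectBase

variable {K F : Type*} [Field K] [Field F] [Algebra K F] (p : ℕ) [Fact p.Prime] [CharP K p]
  [PerfectField K]

variable (K) in
theorem algebraMap_mem_fieldRange_iterateFrobenius [CharP F p] (n : ℕ) (k : K) :
    algebraMap K F k ∈ (iterateFrobenius F p n).fieldRange := by
  have : PerfectRing K p := PerfectField.toPerfectRing p
  obtain ⟨l, rfl⟩ := (bijective_iterateFrobenius K p n).2 k
  exact ⟨algebraMap K F l, by simp [iterateFrobenius_def]⟩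

variable (K) in
theorem finiteDimensional_fieldRange_iterateFrobenius [CharP F p]
    (hF : (⊤ : IntermediateField K F).FG) (n : ℕ) :
    FiniteDimensional (iterateFrobenius F p n).fieldRange F := by
  set L := (iterateFrobenius F p n).fieldRange
  obtain ⟨S, hS⟩ := hF
  -- Perfectness puts `K` inside `L`, so generators over `K` also generate over `L`.
  have htop : IntermediateField.adjoin L (S : Set F) = ⊤ := by
    let M : IntermediateField K F :=
      { (IntermediateField.adjoin L (S : Set F)).toSubfield with
        algebraMap_mem' := fun k => (IntermediateField.adjoin L (S : Set F)).algebraMap_mem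
          ⟨_, algebraMap_mem_fieldRange_iterateFrobenius K p n k⟩ }
    have hM : (⊤ : IntermediateField K F) ≤ M :=
      hS ▸ IntermediateField.adjoin_le_iff.2 (IntermediateField.subset_adjoin L _)
    exact top_le_iff.1 fun x _ => hM (x := x) trivial
  have : FiniteDimensional L (IntermediateField.adjoin L (S : Set F)) := by
    refine IntermediateField.finiteDimensional_adjoin fun x _ => ?_
    refine IsIntegral.of_pow (pow_pos (Fact.out : p.Prime).pos n) ?_
    exact isIntegral_algebraMap (R := L) (A := F) (x := ⟨x ^ p ^ n, x, rfl⟩)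
  rw [htop] at this
  exact IntermediateField.topEquiv.toLinearEquiv.finiteDimensional

/-- An additive map that is linear over the `p ^ n`-th powers is linear over every perfect
subfield. -/
noncomputable def endOfFrobeniusLinear (K : Type*) [Field K] [Algebra K F] [CharP K p]
    [PerfectField K] [CharP F p] (n : ℕ) (f : F →ₗ[(iterateFrobenius F p n).fieldRange] F) :
    Module.End K F where
  toFun := f
  map_add' := f.map_add
  map_smul' k x := by
    rw [Algebra.smul_def, RingHom.id_apply, Algebra.smul_def]
    exact f.map_smul ⟨_, algebraMap_mem_fieldRange_iterateFrobenius K p n k⟩ x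

theorem isFrobeniusLinear_endOfFrobeniusLinear [CharP F p] (n : ℕ)
    (f : F →ₗ[(iterateFrobenius F p n).fieldRange] F) :
    IsFrobeniusLinear p n (endOfFrobeniusLinear p K n f) :=
  fun r x => f.map_smul ⟨r ^ p ^ n, r, rfl⟩ x

variable (K) in
/-- Dual bases of `F` over its subfield of `p ^ n`-th powers, the coordinate functions being
viewed as `K`-linear endomorphisms of `F`. -/
theorem exists_frobeniusLinear_dual_basis [CharP F p] (hF : (⊤ : IntermediateField K F).FG)
    (n : ℕ) :
    ∃ (m : ℕ) (e : Fin m → F) (d : Fin m → Module.End K F),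
      (∀ i, IsFrobeniusLinear p n (d i)) ∧ (∀ i a, ∃ r, d i a = r ^ p ^ n) ∧
      ∀ a, ∑ i, d i a * e i = a := by
  have := finiteDimensional_fieldRange_iterateFrobenius K p hF n
  let L := (iterateFrobenius F p n).fieldRange
  let b := Module.finBasis L F
  refine ⟨_, b, fun i => endOfFrobeniusLinear p K n ((Algebra.linearMap L F) ∘ₗ b.coord i),
    fun i => isFrobeniusLinear_endOfFrobeniusLinear p n _, fun i a => ?_, fun a => b.sum_repr a⟩
  obtain ⟨r, hr⟩ := (b.coord i a).2
  exact ⟨r, hr.symm⟩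

end PerfectBase

theorem smul_mem_diffOp {K B : Type*} [CommRing K] [CommRing B] [Algebra K B] (b : B)
    {u : Module.End K B} (hu : u ∈ diffOp K B) : b • u ∈ diffOp K B :=
  let ⟨i, hi⟩ := hu
  ⟨i, Submodule.smul_mem _ b hi⟩

/-! ### Unique extension and the spanning statement. -/

section Main

variable {K F E : Type*} [Field K] [Field F] [Field E] [Algebra K F] [Algebra K E] [Algebra F E]
  [IsScalarTower K F E]

variable (F) in
theorem diffOp_ext_of_isSeparable (p : ℕ) [Fact p.Prime] [CharP K p]
    [Algebra.IsSeparable F E] {v v' : Module.End K E}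
    (hv : v ∈ diffOp K E) (hv' : v' ∈ diffOp K E)
    (h : ∀ a : F, v (algebraMap F E a) = v' (algebraMap F E a)) : v = v' := by
  have : CharP F p := charP_of_injective_algebraMap (algebraMap K F).injective p
  obtain ⟨m, hm⟩ := exists_isFrobeniusLinear_of_mem_diffOp p hv
  obtain ⟨n, hn⟩ := exists_isFrobeniusLinear_of_mem_diffOp p hv'
  exact (hm.of_le (le_max_left m n)).ext_of_isSeparable F p (hn.of_le (le_max_right m n)) h

theorem exists_diffOp_extends (p : ℕ) [Fact p.Prime] [CharP K p]
    [Algebra.IsSeparable F E] [Algebra.EssFiniteType K E]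
    {u : Module.End K F} (hu : u ∈ diffOp K F) : ∃ v ∈ diffOp K E, OpExtends u v := by
  have : CharP F p := charP_of_injective_algebraMap (algebraMap K F).injective p
  obtain ⟨n, hn⟩ := exists_isFrobeniusLinear_of_mem_diffOp p hu
  obtain ⟨v, hv, huv⟩ := hn.exists_extends E p
  exact ⟨v, hv.mem_diffOp p, huv⟩

theorem mem_span_extends_of_mem_diffOp (p : ℕ) [Fact p.Prime] [CharP K p]
    [PerfectField K] [Algebra.IsSeparable F E]
    (hF : (⊤ : IntermediateField K F).FG) (hE : (⊤ : IntermediateField K E).FG)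
    {v : Module.End K E} (hv : v ∈ diffOp K E) :
    v ∈ Submodule.span E {v' | v' ∈ diffOp K E ∧ ∃ u ∈ diffOp K F, OpExtends u v'} := by
  have : CharP F p := charP_of_injective_algebraMap (algebraMap K F).injective p
  have := IntermediateField.fg_top_iff.1 hF
  have := IntermediateField.fg_top_iff.1 hE
  obtain ⟨n, hn⟩ := exists_isFrobeniusLinear_of_mem_diffOp p hv
  obtain ⟨m, e, d, hd, hpow, hsum⟩ := exists_frobeniusLinear_dual_basis K p hF n
  choose d' hd' hext using fun i => (hd i).exists_extends E p
  have key : v = ∑ i, v (algebraMap F E (e i)) • d' i := by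
    refine hn.ext_of_isSeparable F p (fun r x => ?_) fun a => ?_
    · simp only [LinearMap.sum_apply, LinearMap.smul_apply, hd' _ r x, smul_eq_mul,
        Finset.mul_sum]
      exact Finset.sum_congr rfl fun i _ => mul_left_comm _ _ _
    · conv_lhs => rw [← hsum a, map_sum, map_sum]
      rw [LinearMap.sum_apply]
      refine Finset.sum_congr rfl fun i _ => ?_
      -- The coordinate of `a` is a `p ^ n`-th power, so `v` is linear over it.
      obtain ⟨r, hr⟩ := hpow i a
      rw [LinearMap.smul_apply, hext i a, hr, map_mul, map_pow, hn, smul_eq_mul, mul_comm]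
  rw [key]
  exact Submodule.sum_mem _ fun i _ => Submodule.smul_mem _ _ <| Submodule.subset_span
    ⟨(hd' i).mem_diffOp p, d i, (hd i).mem_diffOp p, hext i⟩

end Main

theorem corollary2p13 {K Q Q' : Type*} [Field K] [Field Q] [Field Q']
    (p : ℕ) (hp : p.Prime) [CharP K p] [PerfectField K]
    [Algebra K Q] [Algebra K Q'] [Algebra Q Q'] [IsScalarTower K Q Q']
    (hQ : (⊤ : IntermediateField K Q).FG) (hQ' : (⊤ : IntermediateField K Q').FG)
    (hsep : Algebra.IsSeparable Q Q') :
    ∃ ι : diffOp K Q →ₐ[K] diffOp K Q',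
      Function.Injective ι ∧
      (∀ (u : diffOp K Q) (v : diffOp K Q'),
        OpExtends (u : Module.End K Q) (v : Module.End K Q') ↔ v = ι u) ∧
      (diffOp K Q' : Set (Module.End K Q')) =
        Submodule.span Q' (Set.range fun u : diffOp K Q => (ι u : Module.End K Q')) := by
  have : Fact p.Prime := ⟨hp⟩
  have := IntermediateField.fg_top_iff.1 hQ'
  have uniq {u : Module.End K Q} {v v' : diffOp K Q'} (hv : OpExtends u (v : Module.End K Q'))
      (hv' : OpExtends u (v' : Module.End K Q')) : v = v' :=
    Subtype.ext <| diffOp_ext_of_isSeparable Q p v.2 v'.2 fun a => (hv a).trans (hv' a).symm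
  choose f hf hext using fun u : diffOp K Q => exists_diffOp_extends (E := Q') p u.2
  let g (u : diffOp K Q) : diffOp K Q' := ⟨f u, hf u⟩
  have hg (u : diffOp K Q) : OpExtends (u : Module.End K Q) (g u : Module.End K Q') := hext u
  let ι : diffOp K Q →ₐ[K] diffOp K Q' :=
    { toFun := g
      map_one' := uniq (hg 1) fun a => rfl
      map_zero' := uniq (hg 0) fun a => by simp
      map_mul' := fun u v => uniq (hg (u * v)) fun a => by
        simp [hg v a, hg u (v.1 a)]
      map_add' := fun u v => uniq (hg (u + v)) fun a => by
        simp [hg v a, hg u a]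
      commutes' := fun k => uniq (hg (algebraMap K _ k)) fun a => by
        simp [Algebra.smul_def, ← IsScalarTower.algebraMap_apply] }
  have hι (u : diffOp K Q) : OpExtends (u : Module.End K Q) (ι u : Module.End K Q') := hg u
  refine ⟨ι, fun u v huv => ?_, fun u v => ⟨fun h => uniq h (hι u), fun h => h ▸ hι u⟩, ?_⟩
  · refine Subtype.ext <| LinearMap.ext fun a => (algebraMap Q Q').injective ?_
    rw [← hι u a, ← hι v a, huv]
  · refine Set.Subset.antisymm (fun v hv => ?_) fun v hv => ?_
    · refine Submodule.span_mono ?_ (mem_span_extends_of_mem_diffOp (F := Q) p hQ hQ' hv)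
      rintro v' ⟨hv', u, hu, huv⟩
      exact ⟨⟨u, hu⟩, congrArg Subtype.val (uniq (v' := ⟨v', hv'⟩) (hι ⟨u, hu⟩) huv)⟩
    · induction hv using Submodule.span_induction with
      | mem x hx =>
        obtain ⟨u, rfl⟩ := hx
        exact (ι u).2
      | zero => exact (diffOp K Q').zero_mem
      | add x y _ _ hx hy => exact (diffOp K Q').add_mem hx hy
      | smul b x _ hx => exact smul_mem_diffOp b hx
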